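/- Let $\mathbb{T}=\mathbb{R}/\mathbb{Z}$, $I=(0,1)$, $Q=\mathbb{T}\times I$. For $u\in L^2(Q)$ with time Fourier coefficients $u_k(x)=\int_{\mathbb{T}}u(t,x)e^{-2\pi i k t}\,dt$ ($k\in\mathbb{Z}$), let $$D_t^{1/2}u=\sum_{k\in\mathbb{Z}}(2\pi i k)^{1/2}\,u_k\,e^{2\pi i k t}$$ (principal branch), and let $u_x$ be the weak derivative in $x$. Let $H^{1/2,1}(Q)$ be the space of all (real- or complex-valued) $u\in L^2(Q)$ with $D_t^{1/2}u\in L^2(Q)$ and $u_x\in L^2(Q)$, with the norm $\big(\|u\|_{L^2(Q)}^2+\|D_t^{1/2}u\|_{L^2(Q)}^2+\|u_x\|_{L^2(Q)}^2\big)^{1/2}$, and let $H^{1/2,1}_0(Q)$ be the closure in $H^{1/2,1}(Q)$ of the space of smooth functions with compact support in $\mathbb{T}\times I$. There exists a constant $C\in\mathbb{R}$ such that every $u\in H^{1/2,1}_0(Q)$ belongs to $L^4(Q)$ and satisfies $$\int_Q |u|^4\,dt\,dx\le C^2\left(\int_Q|u|^2\,dt\,dx+\int_Q|D_t^{1/2}u|^2\,dt\,dx\right)\cdot\left(\int_Q|u_x|^2\,dt\,dx\right)$$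 and, with the same constant, $$\|u^2\|_{L^2(Q)}\le C\,\|u\|\,\|u_x\|_{L^2(Q)},$$ where $\|u\|$ may be taken to be either the norm of $H^{1/2,1}(Q)$ above, or the equivalent norm $\big(\|D_t^{1/2}u\|_{L^2(Q)}^2+\|u_x\|_{L^2(Q)}^2\big)^{1/2}$ on $H^{1/2,1}_0(Q)$. -/

import Mathlib

open MeasureTheory Set
open scoped ContDiff

noncomputable section

/-- The measure `dt dx` of the domain `Q = 𝕋 × (0,1)`, `𝕋 = ℝ/ℤ`, as a measure on `𝕋 × ℝ`. -/
def volQ : Measure (UnitAddCircle × ℝ) :=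
  (volume : Measure UnitAddCircle).prod (volume.restrict (Ioo (0 : ℝ) 1))

/-- The test functions `𝓓(𝕋 × (0,1))`: smooth functions, one-periodic in time, whose support
is a compact subset of `𝕋 × (0,1)`. -/
structure IsTestFunction (φ : UnitAddCircle × ℝ → ℂ) : Prop where
  smooth : ContDiff ℝ ∞ (fun p : ℝ × ℝ => φ ((p.1 : UnitAddCircle), p.2))
  hasCompactSupport : HasCompactSupport φ
  tsupport_subset : tsupport φ ⊆ univ ×ˢ Ioo (0 : ℝ) 1

/-- The classical partial derivative in the space variable. -/
def partialX (φ : UnitAddCircle × ℝ → ℂ) (p : UnitAddCircle × ℝ) : ℂ :=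
  deriv (fun x : ℝ => φ (p.1, x)) p.2

/-- `w = u_x` weakly (in the sense of distributions) on `Q`. -/
def IsWeakDerivX (u w : UnitAddCircle × ℝ → ℂ) : Prop :=
  ∀ φ : UnitAddCircle × ℝ → ℂ, IsTestFunction φ →
    ∫ p, u p * partialX φ p ∂volQ = -∫ p, w p * φ p ∂volQ

/-- The `k`-th Fourier coefficient in time, `u_k(x) = ∫_𝕋 u(t,x) exp(-2πikt) dt`. -/
def timeCoeff (u : UnitAddCircle × ℝ → ℂ) (k : ℤ) (x : ℝ) : ℂ :=
  fourierCoeff (fun t : UnitAddCircle => u (t, x)) k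

/-- `v = D_t^{1/2} u` on `Q`: the time Fourier coefficients satisfy `v_k = (2πik)^{1/2} u_k` in
`L²(0,1)` for every `k` (principal branch of the power, and `0 ^ (1/2) = 0`). -/
def IsHalfDerivT (u v : UnitAddCircle × ℝ → ℂ) : Prop :=
  ∀ k : ℤ, ∀ᵐ x ∂(volume.restrict (Ioo (0 : ℝ) 1)),
    timeCoeff v k x = (2 * Real.pi * Complex.I * k) ^ (1 / 2 : ℂ) * timeCoeff u k x

/-- `u ∈ H^{1/2,1}(Q) = H^{1/2}(𝕋, L²(0,1)) ∩ L²(𝕋, H¹(0,1))`, with `D_t^{1/2} u = v` and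
`u_x = w`. -/
structure IsSobolev (u v w : UnitAddCircle × ℝ → ℂ) : Prop where
  memLp : MemLp u 2 volQ
  memLp_dt : MemLp v 2 volQ
  memLp_dx : MemLp w 2 volQ
  halfDeriv : IsHalfDerivT u v
  weakDeriv : IsWeakDerivX u w

/-- `u ∈ H^{1/2,1}_0(Q)`, the closure of the test functions in `H^{1/2,1}(Q)`, with
`D_t^{1/2} u = v` and `u_x = w`. -/
structure IsSobolevZero (u v w : UnitAddCircle × ℝ → ℂ) : Prop extends IsSobolev u v w where
  approx : ∀ ε : ENNReal, 0 < ε → ∃ φ ψ χ : UnitAddCircle × ℝ → ℂ,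
    IsTestFunction φ ∧ IsSobolev φ ψ χ ∧
      eLpNorm (u - φ) 2 volQ < ε ∧ eLpNorm (v - ψ) 2 volQ < ε ∧ eLpNorm (w - χ) 2 volQ < ε

/-- The `L²(Q)` norm of a square integrable function. -/
def normL (f : UnitAddCircle × ℝ → ℂ) : ℝ :=
  Real.sqrt (∫ p, ‖f p‖ ^ 2 ∂volQ)

/-- The full norm of `H^{1/2,1}(Q)` of a function `u` with `D_t^{1/2} u = v` and `u_x = w`. -/
def normH (u v w : UnitAddCircle × ℝ → ℂ) : ℝ :=
  Real.sqrt (normL u ^ 2 + normL v ^ 2 + normL w ^ 2)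

/-- The equivalent norm of `H^{1/2,1}_0(Q)` of a function `u` with `D_t^{1/2} u = v` and
`u_x = w`, without the `L²` norm of `u` itself. -/
def normHZero (v w : UnitAddCircle × ℝ → ℂ) : ℝ :=
  Real.sqrt (normL v ^ 2 + normL w ^ 2)

end

/-!
The heart of the matter is a Gagliardo–Nirenberg inequality in time for each fixed `x`, combined
with the elementary bound `sup_x ∫_𝕋 |u(t, x)|² dt ≤ ∫_Q |u_x|²` (`lintegral_section_sq_le`), which
holds because `u` vanishes at `x = 0`.

On the circle, `∫ |g|⁴ ≤ 16 (∫ |g|²) ∑ₖ (1 + |k|) |gₖ|²` (`lintegral_pow_four_le`). By Parseval's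
identity the left side is `∑ₙ |(g²)ₙ|²`, and `|(g²)ₙ| ≤ ∑ₖ |gₖ| |gₙ₋ₖ|`. The Cauchy–Schwarz
inequality with weights `w k * w (n - k)`, where `w k = r + |k|`, bounds the sum over `n` by
`(∑ₖ (w k)⁻²) (∑ₖ w k |gₖ|²)²`. Here the first factor is at most `4 / r`, and choosing `r` as the
ratio of `∑ₖ (1 + |k|) |gₖ|²` to `∑ₖ |gₖ|²` gives the product form (`tsum_conv_sq_le_mul`).

For a test function `φ`, applying this to `φ(·, x)` for almost every `x` and integrating over `x`
gives `∫_Q |φ|⁴ ≤ 16 (sup_x ∫_𝕋 |φ(t, x)|² dt) (‖φ‖² + ‖D_t^{1/2} φ‖²)`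
(`IsTestFunction.lintegral_pow_four_le`). The general case follows by approximation and Fatou's
lemma. The bound on `sup_x` also contains the Poincaré inequality `‖u‖ ≤ ‖u_x‖`, which allows the
`L²` norm of `u` to be dropped from the norm of `H^{1/2,1}_0(Q)`.
-/

/-! ### Cauchy–Schwarz inequalities -/

theorem lintegral_mul_sq_le {α : Type*} [MeasurableSpace α] (μ : Measure α) {f g : α → ENNReal}
    (hf : AEMeasurable f μ) (hg : AEMeasurable g μ) :
    (∫⁻ a, f a * g a ∂μ) ^ 2 ≤ (∫⁻ a, f a ^ 2 ∂μ) * ∫⁻ a, g a ^ 2 ∂μ := by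
  have h := ENNReal.lintegral_mul_le_Lp_mul_Lq μ Real.HolderConjugate.two_two hf hg
  simp only [Pi.mul_apply, ENNReal.rpow_two] at h
  calc (∫⁻ a, f a * g a ∂μ) ^ 2
      ≤ ((∫⁻ a, f a ^ 2 ∂μ) ^ (1 / 2 : ℝ) * (∫⁻ a, g a ^ 2 ∂μ) ^ (1 / 2 : ℝ)) ^ 2 := by gcongr
    _ = _ := by
      rw [mul_pow, ← ENNReal.rpow_natCast, ← ENNReal.rpow_mul, ← ENNReal.rpow_natCast,
        ← ENNReal.rpow_mul]
      norm_num

theorem tsum_mul_sq_le (f g : ℤ → ENNReal) :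
    (∑' k, f k * g k) ^ 2 ≤ (∑' k, f k ^ 2) * ∑' k, g k ^ 2 := by
  simpa [lintegral_count] using lintegral_mul_sq_le (Measure.count : Measure ℤ)
    (f := f) (g := g) (measurable_of_countable _).aemeasurable
    (measurable_of_countable _).aemeasurable

/-! ### The convolution square of a weighted sequence -/

theorem tsum_mul_sub_le (f : ℤ → ENNReal) (n : ℤ) :
    ∑' k, f k * f (n - k) ≤ ∑' k, f k ^ 2 := by
  have h := tsum_mul_sq_le f (fun k => f (n - k))
  have e := (Equiv.subLeft n).tsum_eq (fun k => f k ^ 2)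
  simp only [Equiv.subLeft_apply] at e
  rw [e, ← sq] at h
  exact (ENNReal.pow_right_strictMono two_ne_zero).le_iff_le.1 h

theorem tsum_tsum_mul_sub (f : ℤ → ENNReal) :
    ∑' n, ∑' k, f k * f (n - k) = (∑' k, f k) ^ 2 := by
  rw [ENNReal.tsum_comm]
  have (k : ℤ) : ∑' n, f k * f (n - k) = f k * ∑' n, f n := by
    rw [ENNReal.tsum_mul_left, ← (Equiv.subRight k).tsum_eq f]
    rfl
  simp_rw [this, ENNReal.tsum_mul_right, sq]

/-- The Cauchy–Schwarz inequality applied to `∑ₖ a k * a (n - k)` with the weights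
`w k * w (n - k)`, summed over `n`. -/
theorem tsum_conv_sq_le (a w : ℤ → ENNReal) (h0 : ∀ k, w k ≠ 0) (ht : ∀ k, w k ≠ ⊤) :
    ∑' n, (∑' k, a k * a (n - k)) ^ 2 ≤
      (∑' k, (w k)⁻¹ ^ 2) * (∑' k, w k * a k ^ 2) ^ 2 := by
  set s : ℤ → ENNReal := fun k => w k ^ (1 / 2 : ℝ) with hs
  have hsq (k) : s k ^ 2 = w k := by
    simp only [hs]
    rw [← ENNReal.rpow_natCast, ← ENNReal.rpow_mul]
    norm_num
  have hs0 (k) : s k ≠ 0 := fun h => h0 k (by rw [← hsq, h]; simp)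
  have hst (k) : s k ≠ ⊤ := fun h => ht k (by rw [← hsq, h]; simp)
  have key (n : ℤ) : (∑' k, a k * a (n - k)) ^ 2 ≤
      (∑' k, (w k)⁻¹ ^ 2) * ∑' k, (w k * a k ^ 2) * (w (n - k) * a (n - k) ^ 2) := by
    have e (k : ℤ) : a k * a (n - k) =
        ((s k)⁻¹ * (s (n - k))⁻¹) * ((s k * a k) * (s (n - k) * a (n - k))) := by
      have h1 := ENNReal.inv_mul_cancel (hs0 k) (hst k)
      have h2 := ENNReal.inv_mul_cancel (hs0 (n - k)) (hst (n - k))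
      calc a k * a (n - k) =
          ((s k)⁻¹ * s k) * ((s (n - k))⁻¹ * s (n - k)) * (a k * a (n - k)) := by
            rw [h1, h2, one_mul, one_mul]
        _ = _ := by ring
    simp_rw [e]
    refine (tsum_mul_sq_le _ _).trans ?_
    simp_rw [mul_pow, ← ENNReal.inv_pow, hsq]
    gcongr ?_ * _
    simp_rw [ENNReal.inv_pow]
    exact tsum_mul_sub_le (fun k => (w k)⁻¹) n
  calc _ ≤ ∑' n, (∑' k, (w k)⁻¹ ^ 2) * ∑' k, (w k * a k ^ 2) * (w (n - k) * a (n - k) ^ 2) :=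
        ENNReal.tsum_le_tsum key
    _ = _ := by rw [ENNReal.tsum_mul_left, tsum_tsum_mul_sub (fun k => w k * a k ^ 2)]

/-- The sum telescopes after the bound `(r + k)⁻² ≤ 2 / ((r + k) * (r + k + 1))`. -/
theorem sum_range_inv_add_sq_le {r : ℝ} (hr : 1 ≤ r) (n : ℕ) :
    ∑ k ∈ Finset.range n, ((r + k)⁻¹) ^ 2 ≤ 2 / r - 2 / (r + n) := by
  induction n with
  | zero => simp
  | succ n ih =>
    rw [Finset.sum_range_succ]
    have hn : (0 : ℝ) ≤ n := n.cast_nonneg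
    have h : ((r + n)⁻¹) ^ 2 ≤ 2 / (r + n) - 2 / (r + (n + 1 : ℕ)) := by
      push_cast
      rw [div_sub_div _ _ (by positivity) (by positivity), inv_pow, inv_eq_one_div,
        div_le_div_iff₀ (by positivity) (by positivity)]
      nlinarith [mul_nonneg hn hn, mul_nonneg hn (by linarith : (0 : ℝ) ≤ r)]
    linarith

theorem tsum_nat_inv_add_sq_le {r : ℝ} (hr : 1 ≤ r) :
    ∑' k : ℕ, (ENNReal.ofReal r + k)⁻¹ ^ 2 ≤ 2 * (ENNReal.ofReal r)⁻¹ := by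
  refine ENNReal.tsum_le_of_sum_range_le fun n => ?_
  have e (k : ℕ) : (ENNReal.ofReal r + k)⁻¹ ^ 2 = ENNReal.ofReal (((r + k)⁻¹) ^ 2) := by
    rw [ENNReal.ofReal_pow (by positivity), ENNReal.ofReal_inv_of_pos (by positivity),
      ENNReal.ofReal_add (by positivity) (by positivity), ENNReal.ofReal_natCast]
  simp_rw [e]
  rw [← ENNReal.ofReal_sum_of_nonneg (fun _ _ => by positivity)]
  have : (2 : ENNReal) * (ENNReal.ofReal r)⁻¹ = ENNReal.ofReal (2 / r) := by
    rw [div_eq_mul_inv, ENNReal.ofReal_mul (by norm_num),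
      ENNReal.ofReal_inv_of_pos (by positivity)]
    simp
  rw [this]
  refine ENNReal.ofReal_le_ofReal ((sum_range_inv_add_sq_le hr n).trans ?_)
  have : (0 : ℝ) ≤ 2 / (r + n) := by positivity
  linarith

theorem tsum_int_inv_add_sq_le {r : ℝ} (hr : 1 ≤ r) :
    ∑' k : ℤ, (ENNReal.ofReal r + k.natAbs)⁻¹ ^ 2 ≤ 4 * (ENNReal.ofReal r)⁻¹ := by
  rw [tsum_of_nat_of_neg_add_one ENNReal.summable ENNReal.summable]
  have h2 : ∑' k : ℕ, (ENNReal.ofReal r + ((-((k : ℤ) + 1)).natAbs : ℕ))⁻¹ ^ 2 ≤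
      ∑' k : ℕ, (ENNReal.ofReal r + k)⁻¹ ^ 2 := by
    refine ENNReal.tsum_le_tsum fun k => ?_
    gcongr
    omega
  have h1 := tsum_nat_inv_add_sq_le hr
  calc _ ≤ 2 * (ENNReal.ofReal r)⁻¹ + 2 * (ENNReal.ofReal r)⁻¹ :=
        add_le_add (by simpa using h1) (h2.trans h1)
    _ = _ := by ring

/-- A discrete Gagliardo–Nirenberg inequality: the weight `r + |k|` with `r` the quotient of the
two sums on the right balances the two factors of `tsum_conv_sq_le`. -/
theorem tsum_conv_sq_le_mul (a : ℤ → ENNReal) :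
    ∑' n, (∑' k, a k * a (n - k)) ^ 2 ≤
      16 * (∑' k, a k ^ 2) * ∑' k : ℤ, (1 + k.natAbs) * a k ^ 2 := by
  set A := ∑' k, a k ^ 2 with hA
  set H := ∑' k : ℤ, (1 + (k.natAbs : ENNReal)) * a k ^ 2 with hH
  have hAH : A ≤ H := ENNReal.tsum_le_tsum fun k => by
    calc a k ^ 2 = 1 * a k ^ 2 := by simp
      _ ≤ _ := by gcongr; simp
  rcases eq_or_ne A 0 with h0 | h0
  · have h (k) : a k = 0 := by simpa using (ENNReal.tsum_eq_zero.1 h0) k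
    simp [h]
  rcases eq_or_ne H ⊤ with ht | ht
  · simp [ht, h0]
  have hAt : A ≠ ⊤ := (hAH.trans_lt ht.lt_top).ne
  have hH0 : H ≠ 0 := fun h => h0 (by simpa [h] using hAH)
  set r : ℝ := (H / A).toReal with hr
  have hN : ENNReal.ofReal r = H / A := ENNReal.ofReal_toReal (ENNReal.div_ne_top ht h0)
  have hr1 : 1 ≤ r := by
    rw [← ENNReal.one_le_ofReal, hN, ENNReal.le_div_iff_mul_le (Or.inl h0) (Or.inl hAt)]
    simpa using hAH
  refine (tsum_conv_sq_le a (fun k => ENNReal.ofReal r + k.natAbs) (fun k => ?_)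
    (fun k => ?_)).trans ?_
  · simp; intro h; linarith
  · finiteness
  -- `r * A = H` by the choice of `r`, and `∑ |k| * a k ^ 2 ≤ H`.
  have h1 : ∑' k : ℤ, (ENNReal.ofReal r + k.natAbs) * a k ^ 2 ≤ 2 * H := by
    simp_rw [add_mul]
    rw [ENNReal.tsum_add, ENNReal.tsum_mul_left, hN, ← hA, ENNReal.div_mul_cancel h0 hAt, two_mul]
    gcongr
    refine ENNReal.tsum_le_tsum fun k => ?_
    gcongr
    simp
  calc _ ≤ 4 * (ENNReal.ofReal r)⁻¹ * (2 * H) ^ 2 := by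
        gcongr
        exact tsum_int_inv_add_sq_le hr1
    _ = 16 * A * H * (H⁻¹ * H) := by
      rw [hN, ENNReal.inv_div (Or.inl hAt) (Or.inl h0), div_eq_mul_inv]; ring
    _ = _ := by rw [ENNReal.inv_mul_cancel hH0 ht, mul_one]

/-! ### Functions on the circle -/

theorem haarAddCircle_eq_volume : (AddCircle.haarAddCircle : Measure UnitAddCircle) = volume := by
  rw [AddCircle.volume_eq_smul_haarAddCircle]; simp

theorem tsum_enorm_fourierCoeff_sq {g : UnitAddCircle → ℂ} (hg : MemLp g 2 volume) :
    ∑' k, ‖fourierCoeff g k‖ₑ ^ 2 = ∫⁻ t, ‖g t‖ₑ ^ 2 := by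
  rw [← haarAddCircle_eq_volume] at hg ⊢
  have h := hasSum_sq_fourierCoeff hg.toLp
  rw [integral_congr_ae (g := fun t => ‖g t‖ ^ 2)
    (by filter_upwards [hg.coeFn_toLp] with t ht; rw [ht])] at h
  simp_rw [fourierCoeff_congr_ae hg.coeFn_toLp] at h
  have e (z : ℂ) : ‖z‖ₑ ^ 2 = ENNReal.ofReal (‖z‖ ^ 2) := by
    rw [ENNReal.ofReal_pow (norm_nonneg _), ofReal_norm]
  simp_rw [e]
  rw [← ofReal_integral_eq_lintegral_ofReal hg.integrable_norm_pow'
    (by filter_upwards with t; positivity), ← h.tsum_eq,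
    ENNReal.ofReal_tsum_of_nonneg (fun _ => by positivity) h.summable]

/-- Parseval's identity, applied to `g` and `conj g * fourier n`. -/
theorem enorm_fourierCoeff_sq_le_tsum {g : UnitAddCircle → ℂ} (hg : MemLp g 2 volume) (n : ℤ) :
    ‖fourierCoeff (fun t => g t ^ 2) n‖ₑ ≤
      ∑' k, ‖fourierCoeff g k‖ₑ * ‖fourierCoeff g (n - k)‖ₑ := by
  rw [← haarAddCircle_eq_volume] at hg
  have hh : MemLp (fun t => (fourier n t : ℂ) * (starRingEnd ℂ) (g t)) 2
      (AddCircle.haarAddCircle : Measure UnitAddCircle) := by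
    have h1 : MemLp (fun t => (starRingEnd ℂ) (g t)) 2
        (AddCircle.haarAddCircle : Measure UnitAddCircle) := hg.star
    refine h1.of_le ((fourier n).continuous.aestronglyMeasurable.mul h1.1) ?_
    filter_upwards with t
    simp [fourier_apply, Circle.norm_coe]
  have key := fourierBasis.hasSum_inner_mul_inner hh.toLp hg.toLp
  have e1 : inner ℂ hh.toLp hg.toLp = fourierCoeff (fun t => g t ^ 2) n := by
    rw [L2.inner_def, fourierCoeff]
    refine integral_congr_ae ?_
    filter_upwards [hh.coeFn_toLp, hg.coeFn_toLp] with t h1 h2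
    simp only [h1, h2, fourier_neg, RCLike.inner_apply, map_mul, Complex.conj_conj, smul_eq_mul]
    ring
  have e2 (k : ℤ) : inner ℂ (fourierBasis k) hg.toLp = fourierCoeff g k := by
    rw [← HilbertBasis.repr_apply_apply, fourierBasis_repr]
    exact congrFun (fourierCoeff_congr_ae hg.coeFn_toLp) k
  have e3 (k : ℤ) : inner ℂ hh.toLp (fourierBasis k) = fourierCoeff g (n - k) := by
    rw [← inner_conj_symm, ← HilbertBasis.repr_apply_apply, fourierBasis_repr,
      fourierCoeff_congr_ae hh.coeFn_toLp, fourierCoeff, fourierCoeff, ← integral_conj]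
    refine integral_congr_ae ?_
    filter_upwards with t
    have : -(n - k) = k + -n := by ring
    simp only [this, fourier_add, fourier_neg, smul_eq_mul, map_mul, Complex.conj_conj]
    ring
  simp_rw [e1, e2, e3] at key
  rw [← key.tsum_eq]
  refine (enorm_tsum_le_tsum_enorm).trans (le_of_eq ?_)
  simp_rw [enorm_mul, mul_comm]

/-- The Gagliardo–Nirenberg inequality `‖g‖₄⁴ ≤ C ‖g‖₂² ‖g‖²_{H^{1/2}}` on the circle. -/
theorem lintegral_pow_four_le {g : UnitAddCircle → ℂ} (hg : MemLp g 2 volume)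
    (hg2 : MemLp (fun t => g t ^ 2) 2 volume) :
    ∫⁻ t, ‖g t‖ₑ ^ 4 ≤
      16 * (∫⁻ t, ‖g t‖ₑ ^ 2) * ∑' k : ℤ, (1 + k.natAbs) * ‖fourierCoeff g k‖ₑ ^ 2 := by
  have e : ∫⁻ t, ‖g t‖ₑ ^ 4 = ∑' n, ‖fourierCoeff (fun t => g t ^ 2) n‖ₑ ^ 2 := by
    rw [tsum_enorm_fourierCoeff_sq hg2]
    simp_rw [enorm_pow, ← pow_mul]
  rw [e, ← tsum_enorm_fourierCoeff_sq hg]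
  refine le_trans (ENNReal.tsum_le_tsum fun n => ?_) (tsum_conv_sq_le_mul _)
  gcongr
  exact enorm_fourierCoeff_sq_le_tsum hg n

/-! ### Test functions -/

instance isFiniteMeasure_volQ : IsFiniteMeasure volQ := by unfold volQ; infer_instance

namespace IsTestFunction

variable {φ θ : UnitAddCircle × ℝ → ℂ}

theorem continuous (h : IsTestFunction φ) : Continuous φ := by
  -- Continuity is known for the periodic lift and descends along `ℝ × ℝ → 𝕋 × ℝ`.
  have hq : IsOpenQuotientMap (Prod.map ((↑) : ℝ → UnitAddCircle) (id : ℝ → ℝ)) :=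
    QuotientAddGroup.isOpenQuotientMap_mk.prodMap IsOpenQuotientMap.id
  exact hq.continuous_comp_iff.1 h.smooth.continuous

theorem memLp (h : IsTestFunction φ) (p : ENNReal) : MemLp φ p volQ :=
  h.continuous.memLp_of_hasCompactSupport h.hasCompactSupport

theorem hasDerivAt_lift (h : IsTestFunction φ) (t x : ℝ) :
    HasDerivAt (fun y : ℝ => φ ((t : UnitAddCircle), y))
      (fderiv ℝ (fun p : ℝ × ℝ => φ ((p.1 : UnitAddCircle), p.2)) (t, x) (0, 1)) x := by
  have h1 := (h.smooth.differentiable (by simp) (t, x)).hasFDerivAt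
  have h2 : HasDerivAt (fun y : ℝ => (t, y)) ((0 : ℝ), (1 : ℝ)) x :=
    (hasDerivAt_const x t).prodMk (hasDerivAt_id x)
  exact h1.comp_hasDerivAt x h2

theorem hasDerivAt (h : IsTestFunction φ) (t : UnitAddCircle) (x : ℝ) :
    HasDerivAt (fun y : ℝ => φ (t, y)) (partialX φ (t, x)) x := by
  -- `partialX` is a `deriv`, so differentiability along the line, read off from a lift, suffices.
  obtain ⟨s, rfl⟩ := QuotientAddGroup.mk_surjective t
  exact (h.hasDerivAt_lift s x).differentiableAt.hasDerivAt

theorem tsupport_partialX_subset : tsupport (partialX φ) ⊆ tsupport φ := by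
  refine closure_minimal (fun p hp => ?_) (isClosed_tsupport φ)
  by_contra hn
  refine hp ?_
  have h1 := (notMem_tsupport_iff_eventuallyEq.1 hn)
  -- `φ` vanishes near `p`, hence along the line `t = p.1` near `p.2`.
  have h2 : (fun y : ℝ => φ (p.1, y)) =ᶠ[nhds p.2] fun _ => 0 :=
    (Continuous.prodMk_right p.1).continuousAt (x := p.2) |>.eventually h1
  rw [partialX, h2.deriv_eq, deriv_const]

/-- The conjugate of `∂ₓφ` is an admissible test function; it is used in
`lintegral_partialX_sq_le`. -/
theorem conj_partialX (h : IsTestFunction φ) :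
    IsTestFunction (fun p => (starRingEnd ℂ) (partialX φ p)) := by
  have hs : tsupport (fun p => (starRingEnd ℂ) (partialX φ p)) ⊆ tsupport φ := by
    refine (closure_mono fun p hp => ?_).trans tsupport_partialX_subset
    simpa using hp
  refine ⟨?_, h.hasCompactSupport.of_isClosed_subset (isClosed_tsupport _) hs,
    hs.trans h.tsupport_subset⟩
  have e : (fun p : ℝ × ℝ => (starRingEnd ℂ) (partialX φ ((p.1 : UnitAddCircle), p.2))) =
      fun p => Complex.conjCLE
        (fderiv ℝ (fun p : ℝ × ℝ => φ ((p.1 : UnitAddCircle), p.2)) p (0, 1)) := by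
    funext p
    simp only [partialX, (h.hasDerivAt_lift p.1 p.2).deriv]
    rfl
  rw [e]
  refine Complex.conjCLE.contDiff.comp (ContDiff.clm_apply ?_ contDiff_const)
  exact h.smooth.fderiv_right (by simp)

theorem memLp_partialX (h : IsTestFunction φ) (p : ENNReal) : MemLp (partialX φ) p volQ := by
  have e := (h.conj_partialX.memLp p).star
  have e' : (star fun p => (starRingEnd ℂ) (partialX φ p)) = partialX φ := by
    ext p
    simp
  rwa [e'] at e

theorem continuous_partialX (h : IsTestFunction φ) : Continuous (partialX φ) := by
  simpa [Function.comp_def] using Complex.continuous_conj.comp h.conj_partialX.continuous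

theorem eq_zero_of_notMem (h : IsTestFunction φ) (t : UnitAddCircle) {x : ℝ}
    (hx : x ∉ Ioo (0 : ℝ) 1) : φ (t, x) = 0 :=
  image_eq_zero_of_notMem_tsupport fun ht => hx (h.tsupport_subset ht).2

theorem integral_mul_partialX (h : IsTestFunction φ) (h' : IsTestFunction θ) :
    ∫ p, φ p * partialX θ p ∂volQ = -∫ p, partialX φ p * θ p ∂volQ := by
  have i1 : Integrable (fun p => φ p * partialX θ p) volQ :=
    (h.memLp 2).integrable_mul (h'.memLp_partialX 2)
  have i2 : Integrable (fun p => partialX φ p * θ p) volQ :=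
    (h.memLp_partialX 2).integrable_mul (h'.memLp 2)
  unfold volQ at i1 i2 ⊢
  rw [integral_prod _ i1, integral_prod _ i2, ← integral_neg]
  congr 1 with t
  have c (ψ : UnitAddCircle × ℝ → ℂ) (hψ : IsTestFunction ψ) :
      IntervalIntegrable (fun x => partialX ψ (t, x)) volume 0 1 :=
    (hψ.continuous_partialX.comp (Continuous.prodMk_right t)).intervalIntegrable _ _
  have key := intervalIntegral.integral_mul_deriv_eq_deriv_mul (a := 0) (b := 1)
    (fun x _ => h.hasDerivAt t x) (fun x _ => h'.hasDerivAt t x) (c φ h) (c θ h')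
  rw [h.eq_zero_of_notMem t (by simp), h.eq_zero_of_notMem t (by simp), zero_mul, zero_mul,
    sub_self, zero_sub, intervalIntegral.integral_of_le zero_le_one,
    intervalIntegral.integral_of_le zero_le_one, integral_Ioc_eq_integral_Ioo,
    integral_Ioc_eq_integral_Ioo] at key
  exact key

/-- A weak derivative `χ` of a test function `φ` has at least the norm of the classical one, since
`‖∂ₓφ‖² = ∫ ∂ₓφ * conj ∂ₓφ = ∫ χ * conj ∂ₓφ`, the function `conj ∂ₓφ` being itself a test
function. -/
theorem lintegral_partialX_sq_le (h : IsTestFunction φ) {χ : UnitAddCircle × ℝ → ℂ}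
    (hχ : MemLp χ 2 volQ) (hw : IsWeakDerivX φ χ) :
    ∫⁻ p, ‖partialX φ p‖ₑ ^ 2 ∂volQ ≤ ∫⁻ p, ‖χ p‖ₑ ^ 2 ∂volQ := by
  set P := ∫⁻ p, ‖partialX φ p‖ₑ ^ 2 ∂volQ with hP
  have hPt : P ≠ ⊤ := by
    have := (h.memLp_partialX 2).eLpNorm_lt_top
    rw [eLpNorm_lt_top_iff_lintegral_rpow_enorm_lt_top (by simp) (by simp)] at this
    simpa [hP] using this.ne
  rcases eq_or_ne P 0 with h0 | h0
  · simp [h0]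
  have e1 : ∫ p, partialX φ p * (starRingEnd ℂ) (partialX φ p) ∂volQ =
      ∫ p, χ p * (starRingEnd ℂ) (partialX φ p) ∂volQ := by
    rw [← neg_inj, ← h.integral_mul_partialX h.conj_partialX, hw _ h.conj_partialX]
  -- The extended norm of the complex integral of `|∂ₓφ|²` is the lower integral `P`.
  have e2 : P = ‖∫ p, partialX φ p * (starRingEnd ℂ) (partialX φ p) ∂volQ‖ₑ := by
    have e3 : ∫ p, partialX φ p * (starRingEnd ℂ) (partialX φ p) ∂volQ =
        ((∫ p, ‖partialX φ p‖ ^ 2 ∂volQ : ℝ) : ℂ) := by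
      rw [← integral_complex_ofReal]
      simp_rw [Complex.mul_conj, Complex.normSq_eq_norm_sq]
    have e4 (z : ℂ) : ‖z‖ₑ ^ 2 = ENNReal.ofReal (‖z‖ ^ 2) := by
      rw [ENNReal.ofReal_pow (norm_nonneg _), ofReal_norm]
    rw [e3, ← ofReal_norm, Complex.norm_real, Real.norm_of_nonneg (by positivity), hP]
    simp_rw [e4]
    rw [ofReal_integral_eq_lintegral_ofReal (h.memLp_partialX 2).integrable_norm_pow'
      (by filter_upwards with t; positivity)]
  have e5 : P ≤ ∫⁻ p, ‖χ p‖ₑ * ‖partialX φ p‖ₑ ∂volQ := by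
    rw [e2, e1]
    refine (enorm_integral_le_lintegral_enorm _).trans (le_of_eq ?_)
    simp [enorm_mul]
  have e6 : P * P ≤ (∫⁻ p, ‖χ p‖ₑ ^ 2 ∂volQ) * P := by
    calc P * P ≤ (∫⁻ p, ‖χ p‖ₑ * ‖partialX φ p‖ₑ ∂volQ) ^ 2 := by rw [← sq]; gcongr
      _ ≤ _ := lintegral_mul_sq_le volQ hχ.1.enorm (h.memLp_partialX 2).1.enorm
  exact (ENNReal.mul_le_mul_iff_left h0 hPt).1 e6

/-! ### Bounds by the space derivative -/

/-- `sup_x ∫_𝕋 |φ(t, x)|² dt ≤ ∫_Q |∂ₓφ|²`, from `φ(t, x) = ∫₀ˣ ∂ₓφ(t, y) dy`. -/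
theorem lintegral_section_sq_le (h : IsTestFunction φ) (x : ℝ) :
    ∫⁻ t, ‖φ (t, x)‖ₑ ^ 2 ≤ ∫⁻ p, ‖partialX φ p‖ₑ ^ 2 ∂volQ := by
  have hc (t : UnitAddCircle) : Continuous fun y => partialX φ (t, y) :=
    h.continuous_partialX.comp (Continuous.prodMk_right t)
  unfold volQ
  rw [lintegral_prod _ (by
    exact (h.continuous_partialX.enorm.measurable.pow_const 2).aemeasurable)]
  refine lintegral_mono fun t => ?_
  by_cases hx : x ∈ Ioo (0 : ℝ) 1
  swap
  · simp [h.eq_zero_of_notMem t hx]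
  have e1 : φ (t, x) = ∫ y in (0 : ℝ)..x, partialX φ (t, y) := by
    rw [intervalIntegral.integral_eq_sub_of_hasDerivAt (fun y _ => h.hasDerivAt t y)
      ((hc t).intervalIntegrable _ _), h.eq_zero_of_notMem t (x := 0) (by simp), sub_zero]
  have e2 : ‖φ (t, x)‖ₑ ≤ ∫⁻ y in Ioo (0 : ℝ) 1, ‖partialX φ (t, y)‖ₑ * 1 := by
    rw [e1, intervalIntegral.integral_of_le hx.1.le]
    simp_rw [mul_one]
    exact (enorm_integral_le_lintegral_enorm _).trans
      (lintegral_mono_set fun y hy => ⟨hy.1, hy.2.trans_lt hx.2⟩)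
  calc ‖φ (t, x)‖ₑ ^ 2 ≤ (∫⁻ y in Ioo (0 : ℝ) 1, ‖partialX φ (t, y)‖ₑ * 1) ^ 2 := by gcongr
    _ ≤ _ := lintegral_mul_sq_le _ (hc t).enorm.measurable.aemeasurable aemeasurable_const
    _ = _ := by simp

/-- The Poincaré inequality for test functions. -/
theorem lintegral_sq_le (h : IsTestFunction φ) :
    ∫⁻ p, ‖φ p‖ₑ ^ 2 ∂volQ ≤ ∫⁻ p, ‖partialX φ p‖ₑ ^ 2 ∂volQ := by
  conv_lhs => unfold volQ
  rw [lintegral_prod_symm _ (by exact (h.continuous.enorm.measurable.pow_const 2).aemeasurable)]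
  calc _ ≤ ∫⁻ _ in Ioo (0 : ℝ) 1, ∫⁻ p, ‖partialX φ p‖ₑ ^ 2 ∂volQ :=
        lintegral_mono fun x => h.lintegral_section_sq_le x
    _ = _ := by simp

end IsTestFunction

/-! ### The inequality for test functions -/

/-- The squared modulus of the symbol of `D_t^{1/2}`. -/
theorem enorm_cpow_half_sq (k : ℤ) :
    ‖(2 * Real.pi * Complex.I * k : ℂ) ^ (1 / 2 : ℂ)‖ₑ ^ 2 =
      ENNReal.ofReal (2 * Real.pi) * k.natAbs := by
  have e : ((2 * Real.pi * Complex.I * k : ℂ) ^ (1 / 2 : ℂ)) ^ 2 = 2 * Real.pi * Complex.I * k := by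
    simp
  rw [← enorm_pow, e, ← ofReal_norm]
  simp only [norm_mul, Complex.norm_I, Complex.norm_real, Complex.norm_intCast, mul_one,
    Complex.norm_ofNat, Real.norm_eq_abs, abs_of_pos Real.pi_pos]
  rw [ENNReal.ofReal_mul (by positivity), ← Int.cast_abs, Int.abs_eq_natAbs, Int.cast_natCast,
    ENNReal.ofReal_natCast]

theorem memLp_section {f : UnitAddCircle × ℝ → ℂ} (hf : MemLp f 2 volQ) :
    ∀ᵐ x ∂(volume.restrict (Ioo (0 : ℝ) 1)), MemLp (fun t => f (t, x)) 2 volume := by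
  have h1 : ∀ᵐ x ∂(volume.restrict (Ioo (0 : ℝ) 1)),
      AEStronglyMeasurable (fun t => f (t, x)) (volume : Measure UnitAddCircle) :=
    hf.1.prod_swap.prodMk_left
  have h2 := hf.eLpNorm_lt_top
  rw [eLpNorm_lt_top_iff_lintegral_rpow_enorm_lt_top (by simp) (by simp)] at h2
  unfold volQ at h2
  rw [lintegral_prod_symm _ (by exact hf.1.enorm.pow_const _)] at h2
  have h3 := ae_lt_top' (by
    exact (hf.1.enorm.pow_const (2 : ENNReal).toReal).prod_swap.lintegral_prod_right') h2.ne
  filter_upwards [h1, h3] with x hx1 hx3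
  refine ⟨hx1, ?_⟩
  rwa [eLpNorm_lt_top_iff_lintegral_rpow_enorm_lt_top (by simp) (by simp)]

/-- On almost every line `x = const`, the weighted sum of the squared Fourier coefficients is
controlled by `φ` and its half derivative `ψ`. -/
theorem ae_tsum_timeCoeff_le {φ ψ : UnitAddCircle × ℝ → ℂ} (hφ : MemLp φ 2 volQ)
    (hψ : MemLp ψ 2 volQ) (hd : IsHalfDerivT φ ψ) :
    ∀ᵐ x ∂(volume.restrict (Ioo (0 : ℝ) 1)),
      ∑' k : ℤ, (1 + k.natAbs) * ‖timeCoeff φ k x‖ₑ ^ 2 ≤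
        (∫⁻ t, ‖φ (t, x)‖ₑ ^ 2) + ∫⁻ t, ‖ψ (t, x)‖ₑ ^ 2 := by
  filter_upwards [memLp_section hφ, memLp_section hψ, ae_all_iff.2 hd] with x h1 h2 h3
  rw [← tsum_enorm_fourierCoeff_sq h1, ← tsum_enorm_fourierCoeff_sq h2, ← ENNReal.tsum_add]
  refine ENNReal.tsum_le_tsum fun k => ?_
  have e : fourierCoeff (fun t => ψ (t, x)) k = timeCoeff ψ k x := rfl
  rw [e, h3 k, enorm_mul, mul_pow, enorm_cpow_half_sq, add_mul, one_mul]
  have : (1 : ENNReal) ≤ ENNReal.ofReal (2 * Real.pi) := by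
    rw [ENNReal.one_le_ofReal]
    linarith [Real.pi_gt_three]
  change _ ≤ ‖timeCoeff φ k x‖ₑ ^ 2 + _
  gcongr
  calc (k.natAbs : ENNReal) = 1 * k.natAbs := by simp
    _ ≤ _ := by gcongr

/-- The Gagliardo–Nirenberg inequality on the lines `x = const`, integrated over `x`. -/
theorem IsTestFunction.lintegral_pow_four_le {φ ψ χ : UnitAddCircle × ℝ → ℂ}
    (h : IsTestFunction φ) (hs : IsSobolev φ ψ χ) :
    ∫⁻ p, ‖φ p‖ₑ ^ 4 ∂volQ ≤
      16 * ((∫⁻ p, ‖φ p‖ₑ ^ 2 ∂volQ) + ∫⁻ p, ‖ψ p‖ₑ ^ 2 ∂volQ) *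
        ∫⁻ p, ‖χ p‖ₑ ^ 2 ∂volQ := by
  set X := ∫⁻ p, ‖χ p‖ₑ ^ 2 ∂volQ
  have key : ∀ᵐ x ∂(volume.restrict (Ioo (0 : ℝ) 1)), ∫⁻ t, ‖φ (t, x)‖ₑ ^ 4 ≤
      16 * X * ((∫⁻ t, ‖φ (t, x)‖ₑ ^ 2) + ∫⁻ t, ‖ψ (t, x)‖ₑ ^ 2) := by
    filter_upwards [ae_tsum_timeCoeff_le hs.memLp hs.memLp_dt hs.halfDeriv] with x hx
    have hc : Continuous fun t => φ (t, x) := h.continuous.comp (Continuous.prodMk_left x)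
    have hX := (h.lintegral_section_sq_le x).trans
      (h.lintegral_partialX_sq_le hs.memLp_dx hs.weakDeriv)
    refine (_root_.lintegral_pow_four_le
      (hc.memLp_of_hasCompactSupport (HasCompactSupport.of_compactSpace _))
      ((hc.pow 2).memLp_of_hasCompactSupport (HasCompactSupport.of_compactSpace _))).trans ?_
    gcongr
    exact hx
  have m1 : AEMeasurable (fun p => ‖φ p‖ₑ ^ 2)
    ((volume : Measure UnitAddCircle).prod (volume.restrict (Ioo (0 : ℝ) 1))) :=
    hs.memLp.1.enorm.pow_const 2
  have m2 : AEMeasurable (fun p => ‖ψ p‖ₑ ^ 2)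
    ((volume : Measure UnitAddCircle).prod (volume.restrict (Ioo (0 : ℝ) 1))) :=
    hs.memLp_dt.1.enorm.pow_const 2
  have e0 : ∫⁻ p, ‖φ p‖ₑ ^ 4 ∂volQ = ∫⁻ x in Ioo (0 : ℝ) 1, ∫⁻ t, ‖φ (t, x)‖ₑ ^ 4 :=
    lintegral_prod_symm _ (hs.memLp.1.enorm.pow_const 4)
  have e1 : ∫⁻ p, ‖φ p‖ₑ ^ 2 ∂volQ = ∫⁻ x in Ioo (0 : ℝ) 1, ∫⁻ t, ‖φ (t, x)‖ₑ ^ 2 :=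
    lintegral_prod_symm _ m1
  have e2 : ∫⁻ p, ‖ψ p‖ₑ ^ 2 ∂volQ = ∫⁻ x in Ioo (0 : ℝ) 1, ∫⁻ t, ‖ψ (t, x)‖ₑ ^ 2 :=
    lintegral_prod_symm _ m2
  have n1 := m1.prod_swap.lintegral_prod_right'
  have n2 := m2.prod_swap.lintegral_prod_right'
  rw [e0, e1, e2]
  refine (lintegral_mono_ae key).trans (le_of_eq ?_)
  rw [lintegral_const_mul'' _ (by exact n1.add n2), lintegral_add_left' (by exact n1)]
  ring

/-! ### Passage to the closure of the test functions -/

theorem lintegral_enorm_sq_eq (f : UnitAddCircle × ℝ → ℂ) :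
    ∫⁻ p, ‖f p‖ₑ ^ 2 ∂volQ = eLpNorm f 2 volQ ^ 2 := by
  rw [eLpNorm_eq_lintegral_rpow_enorm_toReal (by simp) (by simp), ← ENNReal.rpow_natCast,
    ← ENNReal.rpow_mul]
  simp

theorem eLpNorm_le_add_of_eLpNorm_sub_lt {f g : UnitAddCircle × ℝ → ℂ} (hf : MemLp f 2 volQ)
    (hg : MemLp g 2 volQ) {ε : ENNReal} (h : eLpNorm (f - g) 2 volQ < ε) :
    eLpNorm g 2 volQ ≤ eLpNorm f 2 volQ + ε := by
  have := eLpNorm_sub_le hf.1 (hf.1.sub hg.1) (p := 2) (by norm_num)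
  rw [sub_sub_cancel] at this
  exact this.trans (by gcongr)

namespace IsSobolevZero

variable {u v w : UnitAddCircle × ℝ → ℂ}

/-- The Poincaré inequality on `H^{1/2,1}_0(Q)`. -/
theorem eLpNorm_le (h : IsSobolevZero u v w) : eLpNorm u 2 volQ ≤ eLpNorm w 2 volQ := by
  have key (ε : ENNReal) (hε : 0 < ε) : eLpNorm u 2 volQ ≤ eLpNorm w 2 volQ + ε + ε := by
    obtain ⟨φ, ψ, χ, hφ, hs, h1, -, h3⟩ := h.approx ε hε
    have a1 : eLpNorm u 2 volQ ≤ eLpNorm φ 2 volQ + ε :=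
      eLpNorm_le_add_of_eLpNorm_sub_lt hs.memLp h.memLp (by rwa [eLpNorm_sub_comm])
    have a2 := eLpNorm_le_add_of_eLpNorm_sub_lt h.memLp_dx hs.memLp_dx h3
    have a3 := hφ.lintegral_sq_le.trans (hφ.lintegral_partialX_sq_le hs.memLp_dx hs.weakDeriv)
    rw [lintegral_enorm_sq_eq, lintegral_enorm_sq_eq] at a3
    replace a3 := (ENNReal.pow_right_strictMono two_ne_zero).le_iff_le.1 a3
    exact a1.trans (by gcongr; exact a3.trans a2)
  refine ENNReal.le_of_forall_pos_le_add fun ε hε _ => ?_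
  have h2 : (0 : ENNReal) < ε / 2 := ENNReal.half_pos (by exact_mod_cast hε.ne')
  simpa [add_assoc, ENNReal.add_halves] using key _ h2

/-- Fatou's lemma along a sequence of test functions that converges almost everywhere. -/
theorem lintegral_pow_four_le (h : IsSobolevZero u v w) :
    ∫⁻ p, ‖u p‖ₑ ^ 4 ∂volQ ≤
      16 * (eLpNorm u 2 volQ ^ 2 + eLpNorm v 2 volQ ^ 2) * eLpNorm w 2 volQ ^ 2 := by
  set ε : ℕ → ENNReal := fun n => (n : ENNReal)⁻¹ with hε
  have hε0 : Filter.Tendsto ε Filter.atTop (nhds 0) := ENNReal.tendsto_inv_nat_nhds_zero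
  choose φ ψ χ hφ hs h1 h2 h3 using fun n => h.approx (ε n) (by simp [hε])
  have hlim : Filter.Tendsto (fun n => eLpNorm (φ n - u) 2 volQ) Filter.atTop (nhds 0) := by
    refine tendsto_of_tendsto_of_tendsto_of_le_of_le tendsto_const_nhds hε0
      (fun _ => zero_le) (fun n => ?_)
    change eLpNorm (φ n - u) 2 volQ ≤ ε n
    rw [eLpNorm_sub_comm]
    exact (h1 n).le
  obtain ⟨ns, hns, hae⟩ := (tendstoInMeasure_of_tendsto_eLpNorm two_ne_zero
    (fun n => (hs n).memLp.1) h.memLp.1 hlim).exists_seq_tendsto_ae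
  have e1 : ∫⁻ p, ‖u p‖ₑ ^ 4 ∂volQ =
      ∫⁻ p, Filter.liminf (fun n => ‖φ (ns n) p‖ₑ ^ 4) Filter.atTop ∂volQ := by
    refine lintegral_congr_ae ?_
    filter_upwards [hae] with p hp
    exact ((ENNReal.continuous_pow 4).continuousAt.tendsto.comp hp.enorm).liminf_eq.symm
  have hε1 : Filter.Tendsto (fun n => ε (ns n)) Filter.atTop (nhds 0) :=
    hε0.comp hns.tendsto_atTop
  have hadd (f : UnitAddCircle × ℝ → ℂ) : Filter.Tendsto
      (fun n => (eLpNorm f 2 volQ + ε (ns n)) ^ 2) Filter.atTop (nhds (eLpNorm f 2 volQ ^ 2)) := by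
    have := (tendsto_const_nhds (x := eLpNorm f 2 volQ)).add hε1
    rw [add_zero] at this
    exact (ENNReal.continuous_pow 2).continuousAt.tendsto.comp this
  have hb : Filter.Tendsto (fun n => 16 * ((eLpNorm u 2 volQ + ε (ns n)) ^ 2 +
      (eLpNorm v 2 volQ + ε (ns n)) ^ 2) * (eLpNorm w 2 volQ + ε (ns n)) ^ 2) Filter.atTop
      (nhds (16 * (eLpNorm u 2 volQ ^ 2 + eLpNorm v 2 volQ ^ 2) * eLpNorm w 2 volQ ^ 2)) := by
    have f1 := h.memLp.eLpNorm_ne_top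
    have f2 := h.memLp_dt.eLpNorm_ne_top
    have f3 := h.memLp_dx.eLpNorm_ne_top
    refine ENNReal.Tendsto.mul (ENNReal.Tendsto.const_mul ((hadd u).add (hadd v)) ?_)
      (Or.inr ?_) (hadd w) (Or.inr ?_)
    · exact Or.inr (by finiteness)
    · finiteness
    · finiteness
  rw [e1]
  refine (lintegral_liminf_le fun n =>
    ((hφ (ns n)).continuous.enorm.measurable.pow_const 4)).trans ?_
  rw [← hb.liminf_eq]
  refine Filter.liminf_le_liminf (Filter.Eventually.of_forall fun n => ?_)
  refine ((hφ (ns n)).lintegral_pow_four_le (hs (ns n))).trans ?_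
  simp_rw [lintegral_enorm_sq_eq]
  gcongr
  · exact eLpNorm_le_add_of_eLpNorm_sub_lt h.memLp (hs _).memLp (h1 _)
  · exact eLpNorm_le_add_of_eLpNorm_sub_lt h.memLp_dt (hs _).memLp_dt (h2 _)
  · exact eLpNorm_le_add_of_eLpNorm_sub_lt h.memLp_dx (hs _).memLp_dx (h3 _)

end IsSobolevZero

theorem integral_norm_pow_eq {f : UnitAddCircle × ℝ → ℂ} (hf : AEStronglyMeasurable f volQ)
    (n : ℕ) : ∫ p, ‖f p‖ ^ n ∂volQ = (∫⁻ p, ‖f p‖ₑ ^ n ∂volQ).toReal := by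
  rw [integral_eq_lintegral_of_nonneg_ae (by filter_upwards with p; positivity)
    (by exact hf.norm.pow n)]
  congr 2 with p
  rw [ENNReal.ofReal_pow (norm_nonneg _), ofReal_norm]

theorem mainTheorem5 :
    ∃ C : ℝ, ∀ u v w : UnitAddCircle × ℝ → ℂ, IsSobolevZero u v w →
      MemLp u 4 volQ ∧
      (∫ p, ‖u p‖ ^ 4 ∂volQ) ≤
        C ^ 2 * ((∫ p, ‖u p‖ ^ 2 ∂volQ) + (∫ p, ‖v p‖ ^ 2 ∂volQ)) * (∫ p, ‖w p‖ ^ 2 ∂volQ) ∧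
      normL (fun p => u p ^ 2) ≤ C * normH u v w * normL w ∧
      normL (fun p => u p ^ 2) ≤ C * normHZero v w * normL w := by
  refine ⟨4, fun u v w h => ?_⟩
  have hu := h.memLp.eLpNorm_ne_top
  have hv := h.memLp_dt.eLpNorm_ne_top
  have hw := h.memLp_dx.eLpNorm_ne_top
  have key := h.lintegral_pow_four_le
  have hfin : 16 * (eLpNorm u 2 volQ ^ 2 + eLpNorm v 2 volQ ^ 2) * eLpNorm w 2 volQ ^ 2 ≠ ⊤ := by
    finiteness
  have hsq {f : UnitAddCircle × ℝ → ℂ} (hf : MemLp f 2 volQ) :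
      ∫ p, ‖f p‖ ^ 2 ∂volQ = (eLpNorm f 2 volQ ^ 2).toReal := by
    rw [integral_norm_pow_eq hf.1, lintegral_enorm_sq_eq]
  have main : (∫ p, ‖u p‖ ^ 4 ∂volQ) ≤
      4 ^ 2 * ((∫ p, ‖u p‖ ^ 2 ∂volQ) + (∫ p, ‖v p‖ ^ 2 ∂volQ)) * (∫ p, ‖w p‖ ^ 2 ∂volQ) := by
    rw [integral_norm_pow_eq h.memLp.1, hsq h.memLp, hsq h.memLp_dt, hsq h.memLp_dx]
    refine (ENNReal.toReal_mono hfin key).trans (le_of_eq ?_)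
    rw [ENNReal.toReal_mul, ENNReal.toReal_mul, ENNReal.toReal_add (by finiteness) (by finiteness)]
    norm_num
  have poincare : (∫ p, ‖u p‖ ^ 2 ∂volQ) ≤ ∫ p, ‖w p‖ ^ 2 ∂volQ := by
    rw [hsq h.memLp, hsq h.memLp_dx]
    exact ENNReal.toReal_mono (by finiteness) (by gcongr; exact h.eLpNorm_le)
  have hnorm (f : UnitAddCircle × ℝ → ℂ) : normL f ^ 2 = ∫ p, ‖f p‖ ^ 2 ∂volQ :=
    Real.sq_sqrt (integral_nonneg fun p => by positivity)
  have hnonneg (f : UnitAddCircle × ℝ → ℂ) : 0 ≤ ∫ p, ‖f p‖ ^ 2 ∂volQ :=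
    integral_nonneg fun p => by positivity
  -- Both choices of the norm dominate `‖u‖² + ‖v‖²`, the second one by the Poincaré inequality.
  have bound (a : ℝ) (ha : (∫ p, ‖u p‖ ^ 2 ∂volQ) + (∫ p, ‖v p‖ ^ 2 ∂volQ) ≤ a) :
      normL (fun p => u p ^ 2) ≤ 4 * Real.sqrt a * normL w := by
    have ha0 : 0 ≤ a := (add_nonneg (hnonneg u) (hnonneg v)).trans ha
    refine Real.sqrt_le_iff.2 ⟨mul_nonneg (by positivity) (Real.sqrt_nonneg _), ?_⟩
    rw [mul_pow, mul_pow, Real.sq_sqrt ha0, hnorm]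
    simp_rw [norm_pow, ← pow_mul]
    refine main.trans ?_
    gcongr
  refine ⟨⟨h.memLp.1, ?_⟩, main, bound _ ?_, bound _ ?_⟩
  · rw [eLpNorm_lt_top_iff_lintegral_rpow_enorm_lt_top (by simp) (by simp)]
    simpa using key.trans_lt hfin.lt_top
  · rw [hnorm, hnorm, hnorm]
    linarith [hnonneg w]
  · rw [hnorm, hnorm]
    linarith
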